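/- Let $\tau\in\mathbb{C}$ with $\operatorname{Im}\tau>0$, put $q=e^{2\pi i\tau}$, and write $q^r=e^{2\pi i r\tau}$ for rational $r$. For $x\in\mathbb{C}\setminus\{0\}$ let $j(x;q):=\sum_{n\in\mathbb{Z}}(-1)^n q^{\binom n2}x^n$, and for integers $a,m$ with $m>0$ let $$J_{a,m}:=j(q^a;q^m),\qquad \overline{J}_{a,m}:=j(-q^a;q^m),\qquad J_m:=J_{m,3m}.$$ For integers $N\ge 1$, $\ell\in\{0,1,\dots,N\}$ and $m\equiv\ell\pmod 2$ let $$\mathcal{C}^N_{m,\ell}(q):=\frac1{J_1^3}\sum_{k\in\mathbb{Z}}\ \sum_{i\ge 0}(-1)^i q^{\frac12 i(i+m)+k((N+2)k+\ell+1)}\Bigl\{q^{\frac12 i(2(N+2)k+\ell+1)}-q^{-\frac12 i(2(N+2)k+\ell+1)}\Bigr\},$$ where the sum over $i$ is carried out first. **Theorem.** Let $\ell\in\{0,1,2\}$, $0\le m<4$ and $m\equiv\ell\pmod 2$. Then $\mathcal{C}^2_{m,\ell}(q)$ is well defined, that is, $J_1\neq0$, the sum over $i$ converges absolutely for every $k$,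 and so does the resulting sum over $k$. Moreover $$q^{-\frac18(m^2-\ell^2)}J_1^3\,\mathcal{C}^2_{m,\ell}(q)=\begin{cases} J_{1,2}\overline{J}_{3,8}&\text{if }\ell=0,\ m=0,\\ q^{1/2}J_{1,2}\overline{J}_{1,8}&\text{if }\ell=0,\ m=2,\\ J_1J_2&\text{if }\ell=1,\ m\in\{1,3\},\\ q^{1/2}J_{1,2}\overline{J}_{1,8}&\text{if }\ell=2,\ m=0,\\ J_{1,2}\overline{J}_{3,8}&\text{if }\ell=2,\ m=2. \end{cases}$$ -/

import Mathlib

namespace StringFunction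

noncomputable section

/-- The power `q ^ r` for rational `r`, where `q = exp (2 π i τ)`: the branch is the one fixed
by `τ`, namely `q ^ r = exp (2 π i r τ)`. -/
def qPow (τ : UpperHalfPlane) (r : ℚ) : ℂ :=
  Complex.exp (2 * Real.pi * Complex.I * (r : ℂ) * (τ : ℂ))

/-- The theta function `j(x; q) = ∑_{n ∈ ℤ} (-1)^n q^{n(n-1)/2} x^n`. The integer division is
exact; the series converges absolutely for `0 < |q| < 1` and `x ≠ 0`. -/
def j (x q : ℂ) : ℂ :=
  ∑' n : ℤ, (-1 : ℂ) ^ n * q ^ (n * (n - 1) / 2) * x ^ n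

/-- `J_{a,m} = j(q^a; q^m)`. -/
def J₂ (τ : UpperHalfPlane) (a m : ℤ) : ℂ :=
  j (qPow τ a) (qPow τ m)

/-- `\overline{J}_{a,m} = j(-q^a; q^m)`. -/
def Jbar (τ : UpperHalfPlane) (a m : ℤ) : ℂ :=
  j (-qPow τ a) (qPow τ m)

/-- `J_m = J_{m,3m}`. -/
def J₁ (τ : UpperHalfPlane) (m : ℤ) : ℂ :=
  J₂ τ m (3 * m)

/-- The `(k, i)` term of the double series defining the string function, namely
`(-1)^i q^{i(i+m)/2 + k((N+2)k+ℓ+1)} (q^{i(2(N+2)k+ℓ+1)/2} - q^{-i(2(N+2)k+ℓ+1)/2})`. -/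
def stringTerm (τ : UpperHalfPlane) (N m ℓ k : ℤ) (i : ℕ) : ℂ :=
  (-1 : ℂ) ^ i *
    qPow τ (1 / 2 * (i : ℚ) * ((i : ℚ) + m) + (k : ℚ) * (((N : ℚ) + 2) * k + ℓ + 1)) *
    (qPow τ (1 / 2 * (i : ℚ) * (2 * ((N : ℚ) + 2) * k + ℓ + 1)) -
      qPow τ (-(1 / 2 * (i : ℚ) * (2 * ((N : ℚ) + 2) * k + ℓ + 1))))

/-- The level `N` string function `𝒞^N_{m,ℓ}(q)` of type `A₁⁽¹⁾` (without its fractional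
leading power of `q`). The double series is an iterated one: the sum over `i` is inside, the sum
over `k` outside. -/
def stringC (τ : UpperHalfPlane) (N m ℓ : ℤ) : ℂ :=
  1 / J₁ τ 1 ^ 3 * ∑' k : ℤ, ∑' i : ℕ, stringTerm τ N m ℓ k i

end

end StringFunction

open StringFunction

/-!
The string function is a Fourier coefficient in `z` of a quotient of a numerator theta series by
`j(z; q)`, and at level 2 the numerators are divisible by `j(z; q)`.

Summing over `i` turns the double series into a sum of values
`recipCoeff q n = ∑_{i ≥ 0} (-1)^i q^{i(i+1)/2 + n i}` of a partial theta series. These satisfy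
`recipCoeff q n = 1 - q^{n+1} recipCoeff q (n+1)` and `recipCoeff q (-n) = q^n recipCoeff q n`,
hence are bounded on `ℤ`, which gives all the convergence. The recursion also shows, by a
telescoping argument, that they form a convolution inverse of the theta coefficients:
`∑_a (-1)^a q^{a(a-1)/2} recipCoeff q (n - a)` is `0` for `n ≠ 0` and, by Jacobi's identity, equals
`(q; q)_∞³` for `n = 0` (`tsum_thetaCoeff_mul_recipCoeff`). This is the expansion of `1 / j(z; q)`
in the annulus `|q| < |z| < 1`, stated without analysis in `z`. Consequently, if the numerator is
`j(z; q) ∑ φ_b z^b`, the coefficient sought is `(q; q)_∞³ φ_N` (`hasSum_conv_mul_recipCoeff`).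

Put `p = q^{1/2}`. For `ℓ = 1` the numerator times `j(q; q²)` is `j(z; q) j(-z; q)`. For `ℓ = 0`
and `ℓ = 2` the combination "first plus `p` times second", times `j(p; p⁴)`, is
`j(z; q) j(-p z; q)` (`mul_stringSum_zero_add_two`); replacing `p` by `-p` leaves the two series
unchanged, and so separates them. The constants are compared through the Jacobi triple product
`j_eq_qProd`, which is obtained, like Jacobi's identity, from its finite form with central
`q`-binomial coefficients by dominated convergence. The parity splitting `j_neg_pow_four` of
`j(-p; p⁴)` then yields the two theta constants with modulus 8.
-/

namespace StringFunction

open Filter Topology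

/-! ### Theta coefficients and their summability -/

/-- The coefficient `(-1)^n q^{n(n-1)/2}` of `x^n` in the theta function `j x q`. -/
noncomputable def thetaCoeff (q : ℂ) (n : ℤ) : ℂ :=
  (-1 : ℂ) ^ n * q ^ (n * (n - 1) / 2)

lemma j_eq_tsum (x q : ℂ) : j x q = ∑' n : ℤ, thetaCoeff q n * x ^ n := rfl

@[simp] lemma thetaCoeff_zero (q : ℂ) : thetaCoeff q 0 = 1 := by simp [thetaCoeff]

lemma thetaCoeff_ne_zero {q : ℂ} (hq0 : q ≠ 0) (n : ℤ) : thetaCoeff q n ≠ 0 :=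
  mul_ne_zero (zpow_ne_zero _ (by norm_num)) (zpow_ne_zero _ hq0)

lemma thetaCoeff_add_one {q : ℂ} (hq0 : q ≠ 0) (n : ℤ) :
    thetaCoeff q (n + 1) = -q ^ n * thetaCoeff q n := by
  have h : (n + 1) * (n + 1 - 1) / 2 = n * (n - 1) / 2 + n := by
    rw [← Int.add_mul_ediv_right _ _ (by norm_num)]; ring_nf
  rw [thetaCoeff, thetaCoeff, h, zpow_add₀ hq0, zpow_add₀ (by norm_num)]
  ring

lemma thetaCoeff_sub_one {q : ℂ} (hq0 : q ≠ 0) (n : ℤ) :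
    thetaCoeff q (n - 1) = -(q / q ^ n) * thetaCoeff q n := by
  have h := thetaCoeff_add_one hq0 (n - 1)
  rw [sub_add_cancel, zpow_sub₀ hq0, zpow_one] at h
  rw [h]
  have := zpow_ne_zero n hq0
  field_simp

lemma thetaCoeff_neg {q : ℂ} (hq0 : q ≠ 0) (n : ℤ) :
    thetaCoeff q (-n) = q ^ n * thetaCoeff q n := by
  have h : (-n) * (-n - 1) / 2 = n * (n - 1) / 2 + n := by
    rw [← Int.add_mul_ediv_right _ _ (by norm_num)]; ring_nf
  rw [thetaCoeff, thetaCoeff, h, zpow_add₀ hq0, zpow_neg, ← inv_zpow]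
  norm_num
  ring

/-- Removes the halved exponent: with `q = p ^ 2` the coefficient is a power of `p`. -/
lemma thetaCoeff_sq (p : ℂ) (n : ℤ) :
    thetaCoeff (p ^ 2) n = (-1 : ℂ) ^ n * p ^ (n * (n - 1)) := by
  rw [thetaCoeff, ← zpow_natCast p 2, ← zpow_mul, Nat.cast_ofNat,
    Int.mul_ediv_cancel' (even_iff_two_dvd.mp (Int.even_mul_pred_self n))]

/-- Ratio test on one half of the theta series; the weight `n + 1` is needed for summation by
parts. -/
lemma summable_nat_thetaCoeff {q x : ℂ} (hq0 : q ≠ 0) (hq : ‖q‖ < 1) (hx : x ≠ 0) :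
    Summable fun n : ℕ => ((n : ℝ) + 1) * ‖thetaCoeff q n * x ^ n‖ := by
  refine summable_of_ratio_test_tendsto_lt_one (l := 0) one_pos ?_ ?_
  · exact Eventually.of_forall fun n => mul_ne_zero (by positivity)
      (norm_ne_zero_iff.mpr (mul_ne_zero (thetaCoeff_ne_zero hq0 _) (pow_ne_zero _ hx)))
  · have h1 : Tendsto (fun n : ℕ => ((n : ℝ) + 1 + 1) / ((n : ℝ) + 1)) atTop (𝓝 1) := by
      have := (tendsto_one_div_add_atTop_nhds_zero_nat (𝕜 := ℝ)).const_add 1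
      rw [add_zero] at this
      refine this.congr fun n => ?_
      field_simp
    have h2 : Tendsto (fun n : ℕ => ‖q‖ ^ n * ‖x‖) atTop (𝓝 0) := by
      simpa using (tendsto_pow_atTop_nhds_zero_of_lt_one (norm_nonneg q) hq).mul_const ‖x‖
    have h3 := h1.mul h2
    rw [mul_zero] at h3
    refine h3.congr fun n => ?_
    have hθ := norm_ne_zero_iff.mpr (thetaCoeff_ne_zero hq0 (n : ℤ))
    have hxn := norm_ne_zero_iff.mpr hx
    have hn : (n : ℝ) + 1 ≠ 0 := by positivity
    push_cast
    rw [thetaCoeff_add_one hq0]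
    simp only [norm_mul, norm_neg, norm_pow, zpow_natCast, Real.norm_eq_abs, abs_norm, pow_succ,
      abs_of_nonneg (show (0 : ℝ) ≤ n + 1 + 1 by positivity),
      abs_of_nonneg (show (0 : ℝ) ≤ n + 1 by positivity)]
    field_simp

lemma summable_weighted_thetaCoeff {q x : ℂ} (hq0 : q ≠ 0) (hq : ‖q‖ < 1) (hx : x ≠ 0) :
    Summable fun n : ℤ => (|(n : ℝ)| + 1) * ‖thetaCoeff q n * x ^ n‖ := by
  refine Summable.of_nat_of_neg ?_ ?_
  · simpa using summable_nat_thetaCoeff hq0 hq hx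
  · refine (summable_nat_thetaCoeff hq0 hq (div_ne_zero hq0 hx)).congr fun n => ?_
    rw [thetaCoeff_neg hq0, div_pow, zpow_neg, zpow_natCast, zpow_natCast]
    simp only [Int.cast_neg, Int.cast_natCast, abs_neg, Nat.abs_cast]
    congr 2
    ring

lemma summable_norm_thetaCoeff_mul {q x : ℂ} (hq0 : q ≠ 0) (hq : ‖q‖ < 1) (hx : x ≠ 0) :
    Summable fun n : ℤ => ‖thetaCoeff q n * x ^ n‖ :=
  (summable_weighted_thetaCoeff hq0 hq hx).of_nonneg_of_le (fun _ => norm_nonneg _) fun n =>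
    le_mul_of_one_le_left (norm_nonneg _) (by linarith [abs_nonneg (n : ℝ)])

lemma summable_norm_thetaCoeff {q : ℂ} (hq0 : q ≠ 0) (hq : ‖q‖ < 1) :
    Summable fun n : ℤ => ‖thetaCoeff q n‖ := by
  simpa using summable_norm_thetaCoeff_mul hq0 hq one_ne_zero

/-- Every Gaussian series `∑ q^{a n² + b n}` with `a > 0` is a theta series in base `q^{2a}`. -/
lemma summable_norm_zpow_quadratic {q : ℂ} (hq0 : q ≠ 0) (hq : ‖q‖ < 1) {a : ℕ} (ha : a ≠ 0)
    (b : ℤ) : Summable fun n : ℤ => ‖q ^ (a * n ^ 2 + b * n)‖ := by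
  have hqa : ‖(q ^ a) ^ 2‖ < 1 := by
    rw [norm_pow, norm_pow, ← pow_mul]
    exact pow_lt_one₀ (norm_nonneg _) hq (by simpa using ha)
  refine (summable_norm_thetaCoeff_mul (pow_ne_zero 2 (pow_ne_zero a hq0)) hqa
    (zpow_ne_zero (a + b) hq0)).congr fun n => ?_
  rw [thetaCoeff_sq, mul_assoc, norm_mul, norm_zpow, norm_neg, norm_one, one_zpow, one_mul,
    ← zpow_natCast q a, ← zpow_mul, ← zpow_mul, ← zpow_add₀ hq0]
  congr 2
  ring

/-! ### Infinite `q`-Pochhammer products -/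

/-- The infinite product `(z; q)_∞ = ∏_{k ≥ 0} (1 - z q^k)`. -/
noncomputable def qProd (z q : ℂ) : ℂ := ∏' k : ℕ, (1 - z * q ^ k)

lemma summable_norm_neg_mul_pow {q : ℂ} (hq : ‖q‖ < 1) (z : ℂ) :
    Summable fun k : ℕ => ‖-(z * q ^ k)‖ := by
  simpa using (summable_geometric_of_lt_one (norm_nonneg q) hq).mul_left ‖z‖

lemma multipliable_one_sub_mul_pow {q : ℂ} (hq : ‖q‖ < 1) (z : ℂ) :
    Multipliable fun k : ℕ => 1 - z * q ^ k := by
  simpa [sub_eq_add_neg] using multipliable_one_add_of_summable (summable_norm_neg_mul_pow hq z)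

lemma tendsto_qProd {q : ℂ} (hq : ‖q‖ < 1) (z : ℂ) :
    Tendsto (fun N : ℕ => ∏ k ∈ Finset.range N, (1 - z * q ^ k)) atTop (𝓝 (qProd z q)) :=
  (multipliable_one_sub_mul_pow hq z).tendsto_prod_tprod_nat

lemma one_sub_pow_ne_zero {q : ℂ} (hq : ‖q‖ < 1) {n : ℕ} (hn : n ≠ 0) : 1 - q ^ n ≠ 0 := by
  intro h
  have h1 : ‖q ^ n‖ = 1 := by rw [← sub_eq_zero.mp h, norm_one]
  rw [norm_pow] at h1
  exact (pow_lt_one₀ (norm_nonneg q) hq hn).ne h1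

lemma qProd_self_ne_zero {q : ℂ} (hq : ‖q‖ < 1) : qProd q q ≠ 0 := by
  have := tprod_one_add_ne_zero_of_summable (f := fun k : ℕ => -(q * q ^ k))
    (fun k => by
      rw [← sub_eq_add_neg, ← pow_succ']
      exact one_sub_pow_ne_zero hq k.succ_ne_zero) (summable_norm_neg_mul_pow hq q)
  simpa only [qProd, sub_eq_add_neg] using this

/-- Splitting the factors of `(z; q)_∞` by the parity of the index. -/
lemma qProd_sq_base {q : ℂ} (hq : ‖q‖ < 1) (z : ℂ) :
    qProd z q = qProd z (q ^ 2) * qProd (z * q) (q ^ 2) := by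
  have hq2 : ‖q ^ 2‖ < 1 := by rw [norm_pow]; exact pow_lt_one₀ (norm_nonneg q) hq two_ne_zero
  have h := (tendsto_qProd hq2 z).mul (tendsto_qProd hq2 (z * q))
  have h2 : Tendsto (fun N : ℕ => 2 * N) atTop atTop :=
    tendsto_id.const_mul_atTop' (by norm_num)
  refine tendsto_nhds_unique ((tendsto_qProd hq z).comp h2) (h.congr fun N => ?_)
  induction N with
  | zero => simp
  | succ N ih =>
    rw [Finset.prod_range_succ, Finset.prod_range_succ, Function.comp_apply,
      show 2 * (N + 1) = 2 * N + 1 + 1 by ring, Finset.prod_range_succ, Finset.prod_range_succ,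
      ← Function.comp_apply (f := fun n => ∏ k ∈ Finset.range n, (1 - z * q ^ k))
        (g := fun N => 2 * N), ← ih]
    ring

/-- Splitting the factors of `(z; q)_∞` by the residue of the index modulo three. -/
lemma qProd_cube_base {q : ℂ} (hq : ‖q‖ < 1) (z : ℂ) :
    qProd z q = qProd z (q ^ 3) * qProd (z * q) (q ^ 3) * qProd (z * q ^ 2) (q ^ 3) := by
  have hq3 : ‖q ^ 3‖ < 1 := by rw [norm_pow]; exact pow_lt_one₀ (norm_nonneg q) hq three_ne_zero
  have h := ((tendsto_qProd hq3 z).mul (tendsto_qProd hq3 (z * q))).mul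
    (tendsto_qProd hq3 (z * q ^ 2))
  have h3 : Tendsto (fun N : ℕ => 3 * N) atTop atTop :=
    tendsto_id.const_mul_atTop' (by norm_num)
  refine tendsto_nhds_unique ((tendsto_qProd hq z).comp h3) (h.congr fun N => ?_)
  induction N with
  | zero => simp
  | succ N ih =>
    rw [Finset.prod_range_succ, Finset.prod_range_succ, Finset.prod_range_succ,
      Function.comp_apply, show 3 * (N + 1) = 3 * N + 1 + 1 + 1 by ring, Finset.prod_range_succ,
      Finset.prod_range_succ, Finset.prod_range_succ,
      ← Function.comp_apply (f := fun n => ∏ k ∈ Finset.range n, (1 - z * q ^ k))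
        (g := fun N => 3 * N), ← ih]
    ring

lemma qProd_mul_qProd_neg {q : ℂ} (hq : ‖q‖ < 1) (z : ℂ) :
    qProd z q * qProd (-z) q = qProd (z ^ 2) (q ^ 2) := by
  have hq2 : ‖q ^ 2‖ < 1 := by rw [norm_pow]; exact pow_lt_one₀ (norm_nonneg q) hq two_ne_zero
  refine tendsto_nhds_unique ((tendsto_qProd hq z).mul (tendsto_qProd hq (-z)))
    ((tendsto_qProd hq2 (z ^ 2)).congr fun N => ?_)
  rw [← Finset.prod_mul_distrib]
  exact Finset.prod_congr rfl fun k _ => by ring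

/-! ### The Jacobi triple product and Jacobi's identity for the cube of the Euler product -/

/-- The finite product `(q; q)_n`. -/
noncomputable def qFac (q : ℂ) (n : ℕ) : ℂ := ∏ k ∈ Finset.range n, (1 - q * q ^ k)

/-- The reciprocal `1 / (q; q)_n`, extended by zero to negative `n`; with this convention
`invQFac_sub_one` holds for all integers. -/
noncomputable def invQFac (q : ℂ) (n : ℤ) : ℂ := if n < 0 then 0 else (qFac q n.toNat)⁻¹

/-- The central `q`-binomial coefficient `[2N; N + n]`, which vanishes for `|n| > N`. -/
noncomputable def centralQBinom (q : ℂ) (N : ℕ) (n : ℤ) : ℂ :=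
  qFac q (2 * N) * (invQFac q (N + n) * invQFac q (N - n))

lemma qFac_succ (q : ℂ) (n : ℕ) : qFac q (n + 1) = qFac q n * (1 - q ^ (n + 1)) := by
  rw [qFac, qFac, Finset.prod_range_succ, pow_succ']

lemma qFac_ne_zero {q : ℂ} (hq : ‖q‖ < 1) (n : ℕ) : qFac q n ≠ 0 :=
  Finset.prod_ne_zero_iff.mpr fun k _ => by
    rw [← pow_succ']; exact one_sub_pow_ne_zero hq k.succ_ne_zero

lemma invQFac_sub_one {q : ℂ} (hq : ‖q‖ < 1) (n : ℤ) :
    invQFac q (n - 1) = (1 - q ^ n) * invQFac q n := by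
  rcases lt_trichotomy n 0 with h | rfl | h
  · simp [invQFac, h, show n - 1 < 0 by lia]
  · simp [invQFac]
  · obtain ⟨k, rfl⟩ : ∃ k : ℕ, n = k + 1 := ⟨(n - 1).toNat, by lia⟩
    have h1 := one_sub_pow_ne_zero hq k.succ_ne_zero
    have h2 := qFac_ne_zero hq k
    simp only [invQFac, add_sub_cancel_right, Int.toNat_natCast, Int.toNat_natCast_add_one,
      show ¬ (k : ℤ) < 0 by lia, show ¬ (k : ℤ) + 1 < 0 by lia, if_false, qFac_succ]
    rw [show (q : ℂ) ^ ((k : ℤ) + 1) = q ^ (k + 1) by norm_cast]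
    field_simp

/-- The recursion that matches multiplication of the finite triple product by its next two
factors. -/
lemma centralQBinom_succ {q : ℂ} (hq0 : q ≠ 0) (hq : ‖q‖ < 1) (N : ℕ) (n : ℤ) :
    centralQBinom q (N + 1) n = (1 + q ^ (2 * N + 1)) * centralQBinom q N n
      + q ^ (N + 1) / q ^ n * centralQBinom q N (n - 1)
      + q ^ (N + 1) * q ^ n * centralQBinom q N (n + 1) := by
  -- All factors are expressed through the two reciprocals at `N + 1 ± n`.
  have a1 : invQFac q (N + n) = (1 - q ^ (N + 1) * q ^ n) * invQFac q (N + 1 + n) := by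
    rw [show (N : ℤ) + n = N + 1 + n - 1 by ring, invQFac_sub_one hq, zpow_add₀ hq0]
    norm_cast
  have a2 : invQFac q (N + (n - 1)) = (1 - q ^ N * q ^ n) * invQFac q (N + n) := by
    rw [show (N : ℤ) + (n - 1) = N + n - 1 by ring, invQFac_sub_one hq, zpow_add₀ hq0]
    norm_cast
  have b1 : invQFac q (N - n) = (1 - q ^ (N + 1) / q ^ n) * invQFac q (N + 1 - n) := by
    rw [show (N : ℤ) - n = N + 1 - n - 1 by ring, invQFac_sub_one hq, zpow_sub₀ hq0]
    norm_cast
  have b2 : invQFac q (N - (n + 1)) = (1 - q ^ N / q ^ n) * invQFac q (N - n) := by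
    rw [show (N : ℤ) - (n + 1) = N - n - 1 by ring, invQFac_sub_one hq, zpow_sub₀ hq0]
    norm_cast
  have hn := zpow_ne_zero n hq0
  simp only [centralQBinom]
  rw [show 2 * (N + 1) = 2 * N + 1 + 1 by ring, qFac_succ, qFac_succ,
    show (N : ℤ) + (n + 1) = N + 1 + n by ring, show (N : ℤ) - (n - 1) = N + 1 - n by ring,
    a2, b2, a1, b1]
  push_cast
  field_simp
  ring

lemma centralQBinom_zero (q : ℂ) (n : ℤ) : centralQBinom q 0 n = if n = 0 then 1 else 0 := by
  rcases lt_trichotomy n 0 with h | rfl | h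
  · simp [centralQBinom, invQFac, h, h.ne]
  · simp [centralQBinom, invQFac, qFac]
  · simp [centralQBinom, invQFac, h, h.ne']

lemma HasSum.congr_terms {ι : Type*} {f g : ι → ℂ} {a b : ℂ} (h : HasSum f a)
    (hfg : ∀ n, g n = f n) (hab : b = a) : HasSum g b := by
  rw [funext hfg, hab]
  exact h

/-- The finite form of the Jacobi triple product. -/
lemma hasSum_centralQBinom {q z : ℂ} (hq0 : q ≠ 0) (hq : ‖q‖ < 1) (hz : z ≠ 0) (N : ℕ) :
    HasSum (fun n : ℤ => centralQBinom q N n * (thetaCoeff q n * z ^ n))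
      (∏ k ∈ Finset.range N, ((1 - z * q ^ k) * (1 - q / z * q ^ k))) := by
  induction N with
  | zero =>
    simp only [centralQBinom_zero, Finset.range_zero, Finset.prod_empty]
    convert hasSum_ite_eq (0 : ℤ) (1 : ℂ) using 2 with n
    split_ifs with h <;> simp [h]
  | succ N ih =>
    have h1 := (Equiv.subRight (1 : ℤ)).hasSum_iff.mpr ih
    have h2 := (Equiv.addRight (1 : ℤ)).hasSum_iff.mpr ih
    have h := ((ih.mul_left (1 + q ^ (2 * N + 1))).add (h1.mul_left (-(z * q ^ N)))).add
      (h2.mul_left (-(q / z * q ^ N)))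
    rw [Finset.prod_range_succ]
    refine HasSum.congr_terms h (fun n => ?_) ?_
    · simp only [Function.comp_apply, Equiv.subRight_apply, Equiv.coe_addRight]
      rw [centralQBinom_succ hq0 hq, thetaCoeff_add_one hq0, thetaCoeff_sub_one hq0,
        zpow_add_one₀ hz, zpow_sub_one₀ hz]
      have := zpow_ne_zero n hq0
      field_simp
      ring
    · generalize ∏ k ∈ Finset.range N, ((1 - z * q ^ k) * (1 - q / z * q ^ k)) = Q
      field_simp
      ring

/-- The derivative at `z = 1` of the finite triple product, which has a simple zero there. -/
lemma hasSum_mul_centralQBinom {q : ℂ} (hq0 : q ≠ 0) (hq : ‖q‖ < 1) (N : ℕ) :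
    HasSum (fun n : ℤ => centralQBinom q (N + 1) n * (n * thetaCoeff q n))
      (-(qFac q N * qFac q (N + 1))) := by
  induction N with
  | zero =>
    have hsupp : ∀ n ∉ ({0, 1, -1} : Finset ℤ),
        centralQBinom q (0 + 1) n * (n * thetaCoeff q n) = 0 := by
      intro n hn
      simp only [Finset.mem_insert, Finset.mem_singleton, not_or] at hn
      rw [centralQBinom_succ hq0 hq, centralQBinom_zero, centralQBinom_zero, centralQBinom_zero,
        if_neg hn.1, if_neg (by lia), if_neg (by lia)]
      ring
    refine HasSum.congr_terms (hasSum_sum_of_ne_finset_zero hsupp) (fun _ => rfl) ?_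
    have e1 : thetaCoeff q 1 = -1 := by simpa using thetaCoeff_add_one hq0 0
    have e2 : thetaCoeff q (-1) = -q := by rw [thetaCoeff_neg hq0, e1]; simp
    rw [Finset.sum_insert (by decide), Finset.sum_insert (by decide), Finset.sum_singleton, e1, e2,
      centralQBinom_succ hq0 hq _ 1, centralQBinom_succ hq0 hq _ (-1)]
    simp [centralQBinom_zero, qFac, hq0]
    ring
  | succ N ih =>
    have h0 := hasSum_centralQBinom hq0 hq one_ne_zero (N + 1)
    rw [Finset.prod_eq_zero (Finset.mem_range.mpr N.succ_pos) (by simp)] at h0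
    simp only [one_zpow, mul_one] at h0
    have h1 := (Equiv.subRight (1 : ℤ)).hasSum_iff.mpr (ih.add h0)
    have h2 := (Equiv.addRight (1 : ℤ)).hasSum_iff.mpr (ih.sub h0)
    have h := ((ih.mul_left (1 + q ^ (2 * (N + 1) + 1))).add (h1.mul_left (-(q ^ (N + 1))))).add
      (h2.mul_left (-(q * q ^ (N + 1))))
    refine HasSum.congr_terms h (fun n => ?_) ?_
    · simp only [Function.comp_apply, Equiv.subRight_apply, Equiv.coe_addRight]
      rw [centralQBinom_succ hq0 hq, thetaCoeff_add_one hq0, thetaCoeff_sub_one hq0]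
      have := zpow_ne_zero n hq0
      push_cast
      field_simp
      ring
    · rw [qFac_succ q (N + 1), qFac_succ q N]
      ring

lemma tendsto_qFac {q : ℂ} (hq : ‖q‖ < 1) : Tendsto (qFac q) atTop (𝓝 (qProd q q)) :=
  tendsto_qProd hq q

lemma tendsto_invQFac {q : ℂ} (hq : ‖q‖ < 1) : Tendsto (invQFac q) atTop (𝓝 (qProd q q)⁻¹) := by
  have h : Tendsto (fun n : ℤ => n.toNat) atTop atTop :=
    tendsto_atTop_atTop.mpr fun b => ⟨b, fun a ha => by lia⟩
  refine (((tendsto_qFac hq).comp h).inv₀ (qProd_self_ne_zero hq)).congr' ?_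
  filter_upwards [eventually_ge_atTop 0] with n hn
  simp [invQFac, not_lt.mpr hn]

lemma tendsto_centralQBinom {q : ℂ} (hq : ‖q‖ < 1) (n : ℤ) :
    Tendsto (fun N => centralQBinom q N n) atTop (𝓝 (qProd q q)⁻¹) := by
  have h2 : Tendsto (fun N : ℕ => 2 * N) atTop atTop := tendsto_id.const_mul_atTop' (by norm_num)
  have h3 : Tendsto (fun N : ℕ => (N : ℤ) + n) atTop atTop :=
    tendsto_atTop_add_const_right _ _ tendsto_natCast_atTop_atTop
  have h4 : Tendsto (fun N : ℕ => (N : ℤ) - n) atTop atTop :=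
    tendsto_atTop_add_const_right _ _ tendsto_natCast_atTop_atTop
  have h := ((tendsto_qFac hq).comp h2).mul
    (((tendsto_invQFac hq).comp h3).mul ((tendsto_invQFac hq).comp h4))
  rwa [mul_inv_cancel_left₀ (qProd_self_ne_zero hq)] at h

lemma exists_norm_centralQBinom_le {q : ℂ} (hq : ‖q‖ < 1) :
    ∃ B : ℝ, ∀ N n, ‖centralQBinom q N n‖ ≤ B := by
  obtain ⟨B, hB⟩ := (Metric.isBounded_range_of_tendsto _ (tendsto_qFac hq)).exists_norm_le
  obtain ⟨D, hD⟩ := (Metric.isBounded_range_of_tendsto _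
    ((tendsto_qFac hq).inv₀ (qProd_self_ne_zero hq))).exists_norm_le
  have hB' : ∀ n, ‖qFac q n‖ ≤ B := fun n => hB _ ⟨n, rfl⟩
  have hD' : ∀ n, ‖invQFac q n‖ ≤ D := fun n => by
    rw [invQFac]
    split_ifs
    · simpa using (norm_nonneg _).trans (hD _ ⟨0, rfl⟩)
    · exact hD _ ⟨_, rfl⟩
  refine ⟨B * (D * D), fun N n => ?_⟩
  rw [centralQBinom, norm_mul, norm_mul]
  have h0 := (norm_nonneg _).trans (hD' 0)
  have h1 := (norm_nonneg _).trans (hB' 0)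
  gcongr
  exacts [hB' _, hD' _, hD' _]

/-- Letting `N → ∞` in a sum weighted by the central `q`-binomial coefficients. -/
lemma tendsto_tsum_centralQBinom {q : ℂ} (hq : ‖q‖ < 1) {f : ℤ → ℂ}
    (hf : Summable fun n => ‖f n‖) :
    Tendsto (fun N => ∑' n, centralQBinom q N n * f n) atTop
      (𝓝 ((qProd q q)⁻¹ * ∑' n, f n)) := by
  obtain ⟨B, hB⟩ := exists_norm_centralQBinom_le hq
  rw [← tsum_mul_left]
  refine tendsto_tsum_of_dominated_convergence (hf.mul_left B)
    (fun n => (tendsto_centralQBinom hq n).mul_const _) (Eventually.of_forall fun N n => ?_)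
  rw [norm_mul]
  exact mul_le_mul_of_nonneg_right (hB N n) (norm_nonneg _)

/-- The Jacobi triple product identity. -/
theorem j_eq_qProd {q z : ℂ} (hq0 : q ≠ 0) (hq : ‖q‖ < 1) (hz : z ≠ 0) :
    j z q = qProd q q * (qProd z q * qProd (q / z) q) := by
  have h1 := tendsto_tsum_centralQBinom hq (summable_norm_thetaCoeff_mul hq0 hq hz)
  have h2 := (tendsto_qProd hq z).mul (tendsto_qProd hq (q / z))
  have h := tendsto_nhds_unique h1 (h2.congr fun N => by
    rw [(hasSum_centralQBinom hq0 hq hz N).tsum_eq, Finset.prod_mul_distrib])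
  rw [← h, mul_inv_cancel_left₀ (qProd_self_ne_zero hq), j_eq_tsum]

/-- Jacobi's identity `∑ (-1)^n n q^{n(n-1)/2} = -(q; q)_∞³`. -/
theorem tsum_mul_thetaCoeff {q : ℂ} (hq0 : q ≠ 0) (hq : ‖q‖ < 1) :
    ∑' n : ℤ, n * thetaCoeff q n = -qProd q q ^ 3 := by
  have hs : Summable fun n : ℤ => ‖(n : ℂ) * thetaCoeff q n‖ := by
    refine (summable_weighted_thetaCoeff hq0 hq one_ne_zero).of_nonneg_of_le
      (fun _ => norm_nonneg _) fun n => ?_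
    rw [norm_mul, one_zpow, mul_one, Complex.norm_intCast]
    gcongr
    linarith
  have h1 := (tendsto_tsum_centralQBinom hq hs).comp (tendsto_add_atTop_nat 1)
  have h2 := ((tendsto_qFac hq).mul ((tendsto_qFac hq).comp (tendsto_add_atTop_nat 1))).neg
  have h := tendsto_nhds_unique h1 (h2.congr fun N => by
    simp only [Function.comp_apply]
    rw [(hasSum_mul_centralQBinom hq0 hq N).tsum_eq])
  have hE := qProd_self_ne_zero hq
  rw [inv_mul_eq_iff_eq_mul₀ hE] at h
  rw [h]
  ring

/-- The theta function vanishes at `x = 1`. -/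
lemma tsum_thetaCoeff {q : ℂ} (hq0 : q ≠ 0) : ∑' n : ℤ, thetaCoeff q n = 0 := by
  -- The involution `n ↦ 1 - n` reverses the sign of every term.
  have h : ∀ n : ℤ, thetaCoeff q (1 - n) = -thetaCoeff q n := fun n => by
    rw [show 1 - n = -n + 1 by ring, thetaCoeff_add_one hq0, thetaCoeff_neg hq0, zpow_neg]
    have := zpow_ne_zero n hq0
    field_simp
  have h2 := (Equiv.subLeft (1 : ℤ)).tsum_eq (thetaCoeff q)
  simp only [Equiv.subLeft_apply, h, tsum_neg] at h2
  exact self_eq_neg.mp h2.symm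

/-! ### Partial theta series as the reciprocal of the theta function -/

/-- The partial theta series `∑_{i ≥ 0} (-1)^i q^{i(i-1)/2} x^i`. -/
noncomputable def partialTheta (q x : ℂ) : ℂ := ∑' i : ℕ, thetaCoeff q i * x ^ i

/-- The value `∑_{i ≥ 0} (-1)^i q^{i(i+1)/2 + n i}` of the partial theta series at `q^{n+1}`. In
the annulus `|q| < |z| < 1` it is, up to a constant, the coefficient of `z^n` in `1 / j(z; q)`. -/
noncomputable def recipCoeff (q : ℂ) (n : ℤ) : ℂ := partialTheta q (q ^ (n + 1))

lemma summable_partialTheta {q x : ℂ} (hq0 : q ≠ 0) (hq : ‖q‖ < 1) (hx : x ≠ 0) :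
    Summable fun i : ℕ => thetaCoeff q i * x ^ i := by
  refine Summable.of_norm ?_
  simpa [Function.comp_def] using
    (summable_norm_thetaCoeff_mul hq0 hq hx).comp_injective Nat.cast_injective

lemma partialTheta_eq {q x : ℂ} (hq0 : q ≠ 0) (hq : ‖q‖ < 1) (hx : x ≠ 0) :
    partialTheta q x = 1 - x * partialTheta q (x * q) := by
  rw [partialTheta, (summable_partialTheta hq0 hq hx).tsum_eq_zero_add, partialTheta,
    ← tsum_mul_left, sub_eq_add_neg, ← tsum_neg]
  congr 1
  · simp
  · refine tsum_congr fun i => ?_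
    push_cast
    rw [thetaCoeff_add_one hq0, mul_pow, zpow_natCast]
    ring

lemma recipCoeff_eq {q : ℂ} (hq0 : q ≠ 0) (hq : ‖q‖ < 1) (n : ℤ) :
    recipCoeff q n = 1 - q ^ (n + 1) * recipCoeff q (n + 1) := by
  rw [recipCoeff, partialTheta_eq hq0 hq (zpow_ne_zero _ hq0), recipCoeff,
    zpow_add_one₀ hq0 (n + 1)]

/-- Both sides satisfy the recursion `recipCoeff_eq` and agree at `n = 0`. In terms of series, the
first `2n` terms of the left side cancel in pairs. -/
lemma recipCoeff_neg_natCast {q : ℂ} (hq0 : q ≠ 0) (hq : ‖q‖ < 1) (n : ℕ) :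
    recipCoeff q (-n) = q ^ n * recipCoeff q n := by
  induction n with
  | zero => simp
  | succ n ih =>
    have h1 := recipCoeff_eq hq0 hq (-((n + 1 : ℕ) : ℤ))
    have h2 := recipCoeff_eq hq0 hq n
    rw [show -((n + 1 : ℕ) : ℤ) + 1 = -n by push_cast; ring, ih, zpow_neg, zpow_natCast,
      inv_mul_cancel_left₀ (pow_ne_zero n hq0), h2] at h1
    rw [h1]
    push_cast
    rw [show q ^ (n + 1) = q ^ ((n : ℤ) + 1) by norm_cast]
    ring

lemma exists_norm_recipCoeff_le {q : ℂ} (hq0 : q ≠ 0) (hq : ‖q‖ < 1) :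
    ∃ B : ℝ, ∀ n, ‖recipCoeff q n‖ ≤ B := by
  have hs : Summable fun i : ℕ => ‖thetaCoeff q i‖ :=
    (summable_norm_thetaCoeff hq0 hq).comp_injective Nat.cast_injective
  have hnat : ∀ n : ℕ, ‖recipCoeff q n‖ ≤ ∑' i : ℕ, ‖thetaCoeff q i‖ := fun n => by
    refine tsum_of_norm_bounded hs.hasSum fun i => ?_
    rw [norm_mul, norm_pow, norm_zpow]
    refine mul_le_of_le_one_right (norm_nonneg _) (pow_le_one₀ (by positivity) ?_)
    exact_mod_cast pow_le_one₀ (n := n + 1) (norm_nonneg q) hq.le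
  refine ⟨∑' i : ℕ, ‖thetaCoeff q i‖, fun n => ?_⟩
  obtain ⟨m, rfl | rfl⟩ := n.eq_nat_or_neg
  · exact hnat m
  · rw [recipCoeff_neg_natCast hq0 hq, norm_mul, norm_pow]
    exact (mul_le_of_le_one_left (norm_nonneg _) (pow_le_one₀ (norm_nonneg q) hq.le)).trans
      (hnat m)

lemma summable_mul_recipCoeff {ι : Type*} {q : ℂ} (hq0 : q ≠ 0) (hq : ‖q‖ < 1) {f : ι → ℂ}
    (hf : Summable fun a => ‖f a‖) (g : ι → ℤ) :
    Summable fun a => f a * recipCoeff q (g a) := by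
  obtain ⟨B, hB⟩ := exists_norm_recipCoeff_le hq0 hq
  refine (hf.mul_right B).of_norm_bounded fun a => ?_
  rw [norm_mul]
  exact mul_le_mul_of_nonneg_left (hB _) (norm_nonneg _)

lemma thetaCoeff_mul_recipCoeff {q : ℂ} (hq0 : q ≠ 0) (hq : ‖q‖ < 1) (n a : ℤ) :
    thetaCoeff q a * recipCoeff q (n - a) =
      thetaCoeff q a + q ^ n * (thetaCoeff q (a - 1) * recipCoeff q (n - (a - 1))) := by
  rw [recipCoeff_eq hq0 hq, thetaCoeff_sub_one hq0, show n - a + 1 = n - (a - 1) by ring,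
    show n - (a - 1) = n + 1 - a by ring, zpow_sub₀ hq0, zpow_add_one₀ hq0]
  have := zpow_ne_zero a hq0
  field_simp
  ring

/-- The sequence `recipCoeff q` is a convolution inverse of the theta coefficients, up to the
factor `(q; q)_∞³`. -/
theorem tsum_thetaCoeff_mul_recipCoeff {q : ℂ} (hq0 : q ≠ 0) (hq : ‖q‖ < 1) (n : ℤ) :
    ∑' a : ℤ, thetaCoeff q a * recipCoeff q (n - a) = if n = 0 then qProd q q ^ 3 else 0 := by
  have hs := summable_norm_thetaCoeff hq0 hq
  have hu := summable_mul_recipCoeff hq0 hq hs fun a => n - a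
  have hv : Summable fun a : ℤ => thetaCoeff q (a - 1) * recipCoeff q (n - (a - 1)) :=
    (Equiv.subRight (1 : ℤ)).summable_iff.mpr hu
  split_ifs with hn
  · -- The recursion exhibits `thetaCoeff` as a difference; sum by parts against `a`.
    subst hn
    have hw : Summable fun a : ℤ => ‖((a : ℂ) + 1) * thetaCoeff q a‖ := by
      refine (summable_weighted_thetaCoeff hq0 hq one_ne_zero).of_nonneg_of_le
        (fun _ => norm_nonneg _) fun a => ?_
      rw [norm_mul, one_zpow, mul_one]
      gcongr
      refine (norm_add_le _ _).trans ?_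
      rw [Complex.norm_intCast, norm_one]
    have hwu := summable_mul_recipCoeff hq0 hq hw fun a => 0 - a
    have hwv : Summable fun a : ℤ =>
        (a : ℂ) * (thetaCoeff q (a - 1) * recipCoeff q (0 - (a - 1))) := by
      refine ((Equiv.subRight (1 : ℤ)).summable_iff.mpr hwu).congr fun a => ?_
      simp only [Function.comp_apply, Equiv.subRight_apply]
      push_cast
      ring
    have hau : Summable fun a : ℤ => (a : ℂ) * (thetaCoeff q a * recipCoeff q (0 - a)) :=
      (hwu.sub hu).congr fun a => by ring
    have e1 : ∑' a : ℤ, ((a : ℂ) + 1) * thetaCoeff q a * recipCoeff q (0 - a) =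
        ∑' a : ℤ, (a : ℂ) * (thetaCoeff q (a - 1) * recipCoeff q (0 - (a - 1))) := by
      rw [← (Equiv.subRight (1 : ℤ)).tsum_eq]
      refine tsum_congr fun a => ?_
      simp only [Equiv.subRight_apply]
      push_cast
      ring
    have e2 : ∑' a : ℤ, thetaCoeff q a * recipCoeff q (0 - a) =
        ∑' a : ℤ, ((a : ℂ) + 1) * thetaCoeff q a * recipCoeff q (0 - a) -
          ∑' a : ℤ, (a : ℂ) * (thetaCoeff q a * recipCoeff q (0 - a)) := by
      rw [← hwu.tsum_sub hau]
      exact tsum_congr fun a => by ring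
    rw [e2, e1, ← hwv.tsum_sub hau, ← neg_neg (qProd q q ^ 3), ← tsum_mul_thetaCoeff hq0 hq,
      ← tsum_neg]
    refine tsum_congr fun a => ?_
    rw [thetaCoeff_mul_recipCoeff hq0 hq 0 a, zpow_zero]
    ring
  · have e : ∑' a : ℤ, thetaCoeff q a * recipCoeff q (n - a) =
        q ^ n * ∑' a : ℤ, thetaCoeff q a * recipCoeff q (n - a) := by
      conv_lhs => rw [tsum_congr (thetaCoeff_mul_recipCoeff hq0 hq n)]
      rw [hs.of_norm.tsum_add (hv.mul_left _), tsum_thetaCoeff hq0, zero_add, tsum_mul_left]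
      congr 1
      exact (Equiv.subRight (1 : ℤ)).tsum_eq fun a => thetaCoeff q a * recipCoeff q (n - a)
    have hqn : q ^ n ≠ 1 := by
      intro h
      have h1 : ‖q‖ ^ n = 1 := by rw [← norm_zpow, h, norm_one]
      exact hn ((zpow_eq_one_iff_right₀ (norm_nonneg q) hq.ne).mp h1)
    by_contra h
    exact hqn (mul_right_cancel₀ h (by rw [one_mul]; exact e.symm))

/-- Extraction of a coefficient: pairing the convolution of the theta coefficients and a sequence
`φ` with the reciprocal of theta returns `φ`. -/
theorem hasSum_conv_mul_recipCoeff {q : ℂ} (hq0 : q ≠ 0) (hq : ‖q‖ < 1) {φ : ℤ → ℂ}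
    (hφ : Summable fun b => ‖φ b‖) (N : ℤ) :
    HasSum (fun r => (∑' a, thetaCoeff q a * φ (r - a)) * recipCoeff q (N - r))
      (qProd q q ^ 3 * φ N) := by
  have hprod : Summable fun x : ℤ × ℤ => ‖thetaCoeff q x.1 * φ x.2‖ :=
    (summable_norm_thetaCoeff hq0 hq).mul_norm hφ
  have h1 : Summable fun x : ℤ × ℤ =>
      thetaCoeff q x.1 * φ x.2 * recipCoeff q (N - x.2 - x.1) :=
    summable_mul_recipCoeff hq0 hq hprod _
  -- the change of variables `(r, a) ↦ (a, b)` with `r = a + b`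
  let e : ℤ × ℤ ≃ ℤ × ℤ :=
    { toFun := fun x => (x.2, x.1 - x.2)
      invFun := fun y => (y.1 + y.2, y.1)
      left_inv := fun x => by ext <;> simp
      right_inv := fun y => by ext <;> simp }
  have h2 : Summable fun x : ℤ × ℤ =>
      thetaCoeff q x.2 * φ (x.1 - x.2) * recipCoeff q (N - (x.1 - x.2) - x.2) :=
    e.summable_iff.mpr h1
  have h1' : Summable fun x : ℤ × ℤ =>
      thetaCoeff q x.2 * φ x.1 * recipCoeff q (N - x.1 - x.2) :=
    (Equiv.prodComm ℤ ℤ).summable_iff.mpr h1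
  have hr : ∀ r, ∑' a, thetaCoeff q a * φ (r - a) * recipCoeff q (N - (r - a) - a) =
      (∑' a, thetaCoeff q a * φ (r - a)) * recipCoeff q (N - r) := fun r => by
    rw [← tsum_mul_right]
    exact tsum_congr fun a => by rw [show N - (r - a) - a = N - r by ring]
  refine (h2.prod.congr hr).hasSum_iff.mpr ?_
  calc ∑' r, (∑' a, thetaCoeff q a * φ (r - a)) * recipCoeff q (N - r)
      = ∑' r, ∑' a, thetaCoeff q a * φ (r - a) * recipCoeff q (N - (r - a) - a) :=
        (tsum_congr hr).symm
    _ = ∑' x : ℤ × ℤ, thetaCoeff q x.1 * φ x.2 * recipCoeff q (N - x.2 - x.1) := by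
        rw [← e.tsum_eq]
        exact h2.tsum_prod.symm
    _ = ∑' b, ∑' a, thetaCoeff q a * φ b * recipCoeff q (N - b - a) := by
        rw [← h1'.tsum_prod, ← (Equiv.prodComm ℤ ℤ).tsum_eq]
        rfl
    _ = ∑' b, φ b * (if N - b = 0 then qProd q q ^ 3 else 0) := by
        refine tsum_congr fun b => ?_
        rw [← tsum_thetaCoeff_mul_recipCoeff hq0 hq, ← tsum_mul_left]
        exact tsum_congr fun a => by ring
    _ = qProd q q ^ 3 * φ N := by
        rw [tsum_eq_single N fun b hb => by rw [if_neg (by lia), mul_zero]]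
        simp [mul_comm]

/-! ### Product formulas for the theta constants -/

lemma tsum_int_even_add_odd {f : ℤ → ℂ} (hf : Summable f) :
    ∑' n, f n = ∑' n, f (2 * n) + ∑' n, f (2 * n + 1) := by
  have h2 : Function.Injective fun n : ℤ => 2 * n := mul_right_injective₀ two_ne_zero
  have h2' : Function.Injective fun n : ℤ => 2 * n + 1 := (add_left_injective 1).comp h2
  have he := h2.hasSum_range_iff.mpr (hf.comp_injective h2).hasSum
  have ho := h2'.hasSum_range_iff.mpr (hf.comp_injective h2').hasSum
  have e2 : (Set.range fun n : ℤ => 2 * n) = {n | Even n} := by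
    ext n; simp [even_iff_exists_two_mul]
  have e2' : (Set.range fun n : ℤ => 2 * n + 1) = {n | Odd n} := by
    ext n; simp only [Set.mem_range, Set.mem_ofPred_eq, Odd, eq_comm]
  exact (he.add_isCompl (by rw [e2, e2']; exact Int.isCompl_even_odd) ho).tsum_eq

lemma thetaCoeff_pow_four (p : ℂ) (n : ℤ) :
    thetaCoeff (p ^ 4) n = (-1 : ℂ) ^ n * p ^ (2 * (n * (n - 1))) := by
  rw [show p ^ 4 = (p ^ 2) ^ 2 by ring, thetaCoeff_sq, ← zpow_natCast p 2, ← zpow_mul,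
    Nat.cast_ofNat]

/-- Euler's pentagonal number theorem. -/
lemma j_self_cube {q : ℂ} (hq0 : q ≠ 0) (hq : ‖q‖ < 1) : j q (q ^ 3) = qProd q q := by
  have hq3 : ‖q ^ 3‖ < 1 := by rw [norm_pow]; exact pow_lt_one₀ (norm_nonneg q) hq three_ne_zero
  rw [j_eq_qProd (pow_ne_zero 3 hq0) hq3 hq0, qProd_cube_base hq q,
    show q ^ 3 / q = q * q by field_simp, show q * q ^ 2 = q ^ 3 by ring]
  ring

lemma j_self_sq {q : ℂ} (hq0 : q ≠ 0) (hq : ‖q‖ < 1) :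
    j q (q ^ 2) * qProd (q ^ 2) (q ^ 2) = qProd q q ^ 2 := by
  have hq2 : ‖q ^ 2‖ < 1 := by rw [norm_pow]; exact pow_lt_one₀ (norm_nonneg q) hq two_ne_zero
  rw [j_eq_qProd (pow_ne_zero 2 hq0) hq2 hq0, qProd_sq_base hq q,
    show q ^ 2 / q = q by field_simp, show q * q = q ^ 2 by ring]
  ring

lemma j_pow_four {p : ℂ} (hp0 : p ≠ 0) (hp : ‖p‖ < 1) :
    j p (p ^ 4) = qProd (p ^ 4) (p ^ 4) * qProd p (p ^ 2) := by
  have hp2 : ‖p ^ 2‖ < 1 := by rw [norm_pow]; exact pow_lt_one₀ (norm_nonneg p) hp two_ne_zero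
  have hp4 : ‖p ^ 4‖ < 1 := by rw [norm_pow]; exact pow_lt_one₀ (norm_nonneg p) hp four_ne_zero
  rw [j_eq_qProd (pow_ne_zero 4 hp0) hp4 hp0, qProd_sq_base hp2 p,
    show p ^ 4 / p = p * p ^ 2 by field_simp, show (p ^ 2) ^ 2 = p ^ 4 by ring]

lemma j_pow_four_mul_neg {p : ℂ} (hp0 : p ≠ 0) (hp : ‖p‖ < 1) :
    j p (p ^ 4) * j (-p) (p ^ 4) = qProd (p ^ 2) (p ^ 2) * qProd (p ^ 4) (p ^ 4) := by
  have hp2 : ‖p ^ 2‖ < 1 := by rw [norm_pow]; exact pow_lt_one₀ (norm_nonneg p) hp two_ne_zero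
  have h := j_pow_four (neg_ne_zero.mpr hp0) (by rwa [norm_neg])
  rw [(by decide : Even 4).neg_pow, (by decide : Even 2).neg_pow] at h
  have h2 := qProd_sq_base hp2 (p ^ 2)
  have h3 := qProd_mul_qProd_neg hp2 p
  rw [show p ^ 2 * p ^ 2 = p ^ 4 by ring, show (p ^ 2) ^ 2 = p ^ 4 by ring] at h2
  rw [show (p ^ 2) ^ 2 = p ^ 4 by ring] at h3
  rw [j_pow_four hp0 hp, h, h2, ← h3]
  ring

/-- The triangular-number series in base `p`, split into its even and odd parts. -/
lemma j_neg_pow_four {p : ℂ} (hp0 : p ≠ 0) (hp : ‖p‖ < 1) :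
    j (-p) (p ^ 4) = j (-(p ^ 2) ^ 3) ((p ^ 2) ^ 8) + p * j (-p ^ 2) ((p ^ 2) ^ 8) := by
  have hp4 : ‖p ^ 4‖ < 1 := by rw [norm_pow]; exact pow_lt_one₀ (norm_nonneg p) hp four_ne_zero
  have h (n : ℤ) : thetaCoeff (p ^ 4) n * (-p) ^ n = p ^ (2 * n ^ 2 - n) := by
    rw [thetaCoeff_pow_four, neg_eq_neg_one_mul p, mul_zpow, mul_mul_mul_comm, ← mul_zpow,
      ← zpow_add₀ hp0]
    norm_num
    ring_nf
  have h' (n b : ℤ) : thetaCoeff ((p ^ 2) ^ 8) n * (-(p ^ b)) ^ n =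
      p ^ (8 * n ^ 2 - 8 * n + b * n) := by
    rw [show (p ^ 2) ^ 8 = (p ^ 4) ^ 4 by ring, thetaCoeff_pow_four, neg_eq_neg_one_mul (p ^ b),
      mul_zpow, mul_mul_mul_comm, ← mul_zpow, ← zpow_natCast p 4, ← zpow_mul, ← zpow_mul,
      ← zpow_add₀ hp0]
    norm_num
    ring_nf
  have hs : Summable fun n : ℤ => thetaCoeff (p ^ 4) n * (-p) ^ n :=
    (summable_norm_thetaCoeff_mul (pow_ne_zero 4 hp0) hp4 (neg_ne_zero.mpr hp0)).of_norm
  rw [j_eq_tsum, tsum_int_even_add_odd hs, j_eq_tsum, j_eq_tsum, ← tsum_mul_left]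
  congr 1
  · refine tsum_congr fun n => ?_
    rw [h, show (p ^ 2) ^ 3 = p ^ (6 : ℤ) by rw [← pow_mul]; norm_cast, h']
    ring_nf
  · rw [← (Equiv.neg ℤ).tsum_eq]
    refine tsum_congr fun n => ?_
    rw [h, show (p ^ 2) = p ^ (2 : ℤ) by norm_cast]
    have h2 := h' n 2
    rw [show (p ^ 2) = p ^ (2 : ℤ) by norm_cast] at h2
    rw [h2, ← zpow_one_add₀ hp0, Equiv.neg_apply]
    ring_nf

/-! ### The numerators as theta convolutions -/

/-- The coefficient of `z^{2u}` in `j(z; q) j(-z; q)`, where `q = p ^ 2`. -/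
lemma tsum_conv_even {p : ℂ} (hp0 : p ≠ 0) (u : ℤ) :
    ∑' a, thetaCoeff (p ^ 2) a * p ^ ((2 * u - a) * (2 * u - a - 1)) =
      j (p ^ 2) (p ^ 4) * ((-1 : ℂ) ^ u * p ^ (2 * u ^ 2 - 2 * u)) := by
  rw [j_eq_tsum, ← tsum_mul_right, ← (Equiv.addLeft u).tsum_eq]
  refine tsum_congr fun t => ?_
  have hsign : (-1 : ℂ) ^ (u + t) = (-1) ^ t * (-1) ^ u := by
    rw [zpow_add₀ (by norm_num), mul_comm]
  rw [Equiv.coe_addLeft, thetaCoeff_sq, thetaCoeff_pow_four, ← zpow_natCast p 2, ← zpow_mul,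
    hsign, mul_assoc, ← zpow_add₀ hp0, mul_assoc _ _ (p ^ (_ * t)), ← zpow_add₀ hp0,
    mul_mul_mul_comm, ← zpow_add₀ hp0]
  congr 2
  push_cast
  ring

/-- The odd coefficients of `j(z; q) j(-z; q)` vanish, since that product is even in `z`. -/
lemma tsum_conv_odd {p : ℂ} (u : ℤ) :
    ∑' a, thetaCoeff (p ^ 2) a * p ^ ((2 * u + 1 - a) * (2 * u + 1 - a - 1)) = 0 := by
  have h := (Equiv.subLeft (2 * u + 1)).tsum_eq
    fun a => thetaCoeff (p ^ 2) a * p ^ ((2 * u + 1 - a) * (2 * u + 1 - a - 1))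
  rw [← self_eq_neg, ← tsum_neg]
  refine h.symm.trans (tsum_congr fun a => ?_)
  have hsign : (-1 : ℂ) ^ (2 * u + 1 - a) = -(-1) ^ a := by
    rw [zpow_sub₀ (by norm_num), zpow_add₀ (by norm_num), zpow_mul, zpow_one, div_eq_mul_inv,
      ← inv_zpow]
    norm_num
  rw [Equiv.subLeft_apply, thetaCoeff_sq, thetaCoeff_sq, hsign, sub_sub_cancel]
  ring

/-- The coefficient of `z^{2u}` in `j(z; q) j(-p z; q)`, where `q = p ^ 2`. -/
lemma tsum_conv_half_even {p : ℂ} (hp0 : p ≠ 0) (u : ℤ) :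
    ∑' a, thetaCoeff (p ^ 2) a * p ^ (2 * u - a) ^ 2 =
      j p (p ^ 4) * ((-1 : ℂ) ^ u * p ^ (2 * u ^ 2 - u)) := by
  rw [j_eq_tsum, ← tsum_mul_right, ← (Equiv.addLeft u).tsum_eq]
  refine tsum_congr fun t => ?_
  have hsign : (-1 : ℂ) ^ (u + t) = (-1) ^ t * (-1) ^ u := by
    rw [zpow_add₀ (by norm_num), mul_comm]
  rw [Equiv.coe_addLeft, thetaCoeff_sq, thetaCoeff_pow_four, hsign, mul_assoc,
    ← zpow_add₀ hp0, mul_assoc _ _ (p ^ t), ← zpow_add₀ hp0, mul_mul_mul_comm, ← zpow_add₀ hp0]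
  congr 2
  ring

/-- The coefficient of `z^{2u+1}` in `j(z; q) j(-p z; q)`, where `q = p ^ 2`. -/
lemma tsum_conv_half_odd {p : ℂ} (hp0 : p ≠ 0) (u : ℤ) :
    ∑' a, thetaCoeff (p ^ 2) a * p ^ (2 * u + 1 - a) ^ 2 =
      j p (p ^ 4) * (-(-1 : ℂ) ^ u * p ^ (2 * u ^ 2 + u)) := by
  rw [j_eq_tsum, ← tsum_mul_right, ← (Equiv.subLeft (u + 1)).tsum_eq]
  refine tsum_congr fun t => ?_
  have hsign : (-1 : ℂ) ^ (u + 1 - t) = (-1) ^ t * -(-1) ^ u := by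
    rw [zpow_sub₀ (by norm_num), zpow_add₀ (by norm_num), zpow_one, div_eq_mul_inv, ← inv_zpow]
    norm_num
    ring
  rw [Equiv.subLeft_apply, thetaCoeff_sq, thetaCoeff_pow_four, hsign, mul_assoc,
    ← zpow_add₀ hp0, mul_assoc _ _ (p ^ t), ← zpow_add₀ hp0, mul_mul_mul_comm, ← zpow_add₀ hp0]
  congr 2
  ring

/-! ### The string function as a coefficient of a theta quotient -/

/-- The level 2 numerator series in terms of `recipCoeff`, with `s = (m + ℓ) / 2`. -/
noncomputable def stringSum (q : ℂ) (ℓ s : ℤ) : ℂ :=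
  ∑' k : ℤ, q ^ (4 * k ^ 2 + (ℓ + 1) * k) *
    (recipCoeff q (4 * k + s) - recipCoeff q (-4 * k + (s - ℓ - 1)))

lemma summable_mul_recipCoeff_quadratic {q : ℂ} (hq0 : q ≠ 0) (hq : ‖q‖ < 1) (b : ℤ) (g : ℤ → ℤ) :
    Summable fun k : ℤ => q ^ (4 * k ^ 2 + b * k) * recipCoeff q (g k) :=
  summable_mul_recipCoeff hq0 hq
    (by exact_mod_cast summable_norm_zpow_quadratic hq0 hq (four_ne_zero (α := ℕ)) b) g

lemma summable_stringSum {q : ℂ} (hq0 : q ≠ 0) (hq : ‖q‖ < 1) (ℓ s : ℤ) :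
    Summable fun k : ℤ => q ^ (4 * k ^ 2 + (ℓ + 1) * k) *
      (recipCoeff q (4 * k + s) - recipCoeff q (-4 * k + (s - ℓ - 1))) := by
  simpa only [mul_sub] using (summable_mul_recipCoeff_quadratic hq0 hq (ℓ + 1) _).sub
    (summable_mul_recipCoeff_quadratic hq0 hq (ℓ + 1) _)

lemma stringSum_eq_sub {q : ℂ} (hq0 : q ≠ 0) (hq : ‖q‖ < 1) (ℓ s : ℤ) :
    stringSum q ℓ s =
      ∑' k : ℤ, q ^ (4 * k ^ 2 + -(ℓ + 1) * k) * recipCoeff q (s - 4 * k) -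
      ∑' k : ℤ, q ^ (4 * k ^ 2 + (ℓ + 1) * k) * recipCoeff q (s - ℓ - 1 - 4 * k) := by
  simp only [stringSum, mul_sub]
  rw [(summable_mul_recipCoeff_quadratic hq0 hq (ℓ + 1) _).tsum_sub
    (summable_mul_recipCoeff_quadratic hq0 hq (ℓ + 1) _), ← (Equiv.neg ℤ).tsum_eq]
  congr 1
  · refine tsum_congr fun k => ?_
    rw [Equiv.neg_apply]
    ring_nf
  · refine tsum_congr fun k => ?_
    ring_nf

lemma sq_zpow (p : ℂ) (n : ℤ) : (p ^ 2) ^ n = p ^ (2 * n) := by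
  rw [← zpow_natCast p 2, ← zpow_mul, Nat.cast_ofNat]

/-- For `ℓ = 1` the numerator is a multiple of `j(z; q) j(-z; q)`. -/
lemma mul_stringSum_one {p : ℂ} (hp0 : p ≠ 0) (hp : ‖p‖ < 1) (s : ℤ) :
    j (p ^ 2) (p ^ 4) * stringSum (p ^ 2) 1 s =
      qProd (p ^ 2) (p ^ 2) ^ 3 * p ^ (s * (s - 1)) := by
  have hq0 : p ^ 2 ≠ 0 := pow_ne_zero 2 hp0
  have hq : ‖p ^ 2‖ < 1 := by rw [norm_pow]; exact pow_lt_one₀ (norm_nonneg p) hp two_ne_zero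
  have hφ : Summable fun b : ℤ => ‖p ^ (b * (b - 1))‖ := by
    refine (summable_norm_zpow_quadratic hp0 hp one_ne_zero (-1)).congr fun b => ?_
    push_cast
    ring_nf
  have H := hasSum_conv_mul_recipCoeff hq0 hq hφ s
  have He := H.summable.comp_injective (mul_right_injective₀ (two_ne_zero' ℤ))
  simp only [Function.comp_def] at He
  rw [← H.tsum_eq, tsum_int_even_add_odd H.summable]
  simp only [tsum_conv_odd, zero_mul, tsum_zero, add_zero]
  rw [tsum_int_even_add_odd He, stringSum_eq_sub hq0 hq, sub_eq_add_neg, ← tsum_neg, mul_add,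
    ← tsum_mul_left, ← tsum_mul_left]
  congr 1
  · refine tsum_congr fun k => ?_
    rw [tsum_conv_even hp0, sq_zpow, (even_two_mul k).neg_one_zpow]
    ring_nf
  · refine tsum_congr fun k => ?_
    rw [tsum_conv_even hp0, sq_zpow, (odd_two_mul_add_one k).neg_one_zpow]
    ring_nf

/-- A linear combination of the numerators for `ℓ = 0` and `ℓ = 2` is a multiple of
`j(z; q) j(-p z; q)`, where `q = p ^ 2`. The residue of the exponent of `z` modulo four tells
which of the four series a term belongs to. -/
lemma mul_stringSum_zero_add_two {p : ℂ} (hp0 : p ≠ 0) (hp : ‖p‖ < 1) (N : ℤ) :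
    j p (p ^ 4) * (stringSum (p ^ 2) 0 N + p * stringSum (p ^ 2) 2 (N + 1)) =
      qProd (p ^ 2) (p ^ 2) ^ 3 * p ^ N ^ 2 := by
  have hq0 : p ^ 2 ≠ 0 := pow_ne_zero 2 hp0
  have hq : ‖p ^ 2‖ < 1 := by rw [norm_pow]; exact pow_lt_one₀ (norm_nonneg p) hp two_ne_zero
  have hφ : Summable fun b : ℤ => ‖p ^ b ^ 2‖ := by
    refine (summable_norm_zpow_quadratic hp0 hp one_ne_zero 0).congr fun b => ?_
    push_cast
    ring_nf
  have H := hasSum_conv_mul_recipCoeff hq0 hq hφ N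
  have h2 : Function.Injective fun n : ℤ => 2 * n := mul_right_injective₀ two_ne_zero
  have He := H.summable.comp_injective h2
  have Ho := H.summable.comp_injective ((add_left_injective 1).comp h2)
  simp only [Function.comp_def] at He Ho
  rw [← H.tsum_eq, tsum_int_even_add_odd H.summable, tsum_int_even_add_odd He,
    tsum_int_even_add_odd Ho]
  have e0 : ∑' k : ℤ, (∑' a, thetaCoeff (p ^ 2) a * p ^ (2 * (2 * k) - a) ^ 2) *
      recipCoeff (p ^ 2) (N - 2 * (2 * k)) =
      j p (p ^ 4) * ∑' k : ℤ, (p ^ 2) ^ (4 * k ^ 2 + -(0 + 1) * k) *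
        recipCoeff (p ^ 2) (N - 4 * k) := by
    rw [← tsum_mul_left]
    refine tsum_congr fun k => ?_
    rw [tsum_conv_half_even hp0, sq_zpow, (even_two_mul k).neg_one_zpow]
    ring_nf
  have e1 : ∑' k : ℤ, (∑' a, thetaCoeff (p ^ 2) a * p ^ (2 * (2 * k) + 1 - a) ^ 2) *
      recipCoeff (p ^ 2) (N - (2 * (2 * k) + 1)) =
      -(j p (p ^ 4) * ∑' k : ℤ, (p ^ 2) ^ (4 * k ^ 2 + (0 + 1) * k) *
        recipCoeff (p ^ 2) (N - 0 - 1 - 4 * k)) := by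
    rw [← tsum_mul_left, ← tsum_neg]
    refine tsum_congr fun k => ?_
    rw [tsum_conv_half_odd hp0, sq_zpow, (even_two_mul k).neg_one_zpow]
    ring_nf
  have e2 : ∑' k : ℤ, (∑' a, thetaCoeff (p ^ 2) a * p ^ (2 * (2 * k + 1) - a) ^ 2) *
      recipCoeff (p ^ 2) (N - 2 * (2 * k + 1)) =
      -(j p (p ^ 4) * p * ∑' k : ℤ, (p ^ 2) ^ (4 * k ^ 2 + (2 + 1) * k) *
        recipCoeff (p ^ 2) (N + 1 - 2 - 1 - 4 * k)) := by
    rw [← tsum_mul_left, ← tsum_neg]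
    refine tsum_congr fun k => ?_
    rw [tsum_conv_half_even hp0, sq_zpow, (odd_two_mul_add_one k).neg_one_zpow,
      show 2 * (2 * k + 1) ^ 2 - (2 * k + 1) = 2 * (4 * k ^ 2 + (2 + 1) * k) + 1 by ring,
      zpow_add_one₀ hp0]
    ring_nf
  have e3 : ∑' k : ℤ, (∑' a, thetaCoeff (p ^ 2) a * p ^ (2 * (2 * k + 1) + 1 - a) ^ 2) *
      recipCoeff (p ^ 2) (N - (2 * (2 * k + 1) + 1)) =
      j p (p ^ 4) * p * ∑' k : ℤ, (p ^ 2) ^ (4 * k ^ 2 + -(2 + 1) * k) *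
        recipCoeff (p ^ 2) (N + 1 - 4 * k) := by
    rw [← tsum_mul_left, ← (Equiv.subRight (1 : ℤ)).tsum_eq]
    refine tsum_congr fun k => ?_
    rw [Equiv.subRight_apply, tsum_conv_half_odd hp0, sq_zpow,
      (odd_two_mul_add_one (k - 1)).neg_one_zpow,
      show 2 * (2 * (k - 1) + 1) ^ 2 + (2 * (k - 1) + 1) = 2 * (4 * k ^ 2 + -(2 + 1) * k) + 1 by
        ring, zpow_add_one₀ hp0]
    ring_nf
  rw [e0, e1, e2, e3, stringSum_eq_sub hq0 hq, stringSum_eq_sub hq0 hq]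
  ring

/-! ### Evaluation of the level 2 numerator series -/

lemma j_pow_four_ne_zero {p : ℂ} (hp0 : p ≠ 0) (hp : ‖p‖ < 1) : j p (p ^ 4) ≠ 0 := by
  refine left_ne_zero_of_mul (b := j (-p) (p ^ 4)) ?_
  rw [j_pow_four_mul_neg hp0 hp]
  have h (n : ℕ) (hn : n ≠ 0) : ‖p ^ n‖ < 1 := by
    rw [norm_pow]; exact pow_lt_one₀ (norm_nonneg p) hp hn
  exact mul_ne_zero (qProd_self_ne_zero (h 2 two_ne_zero)) (qProd_self_ne_zero (h 4 four_ne_zero))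

lemma stringSum_one {p : ℂ} (hp0 : p ≠ 0) (hp : ‖p‖ < 1) (s : ℤ) :
    stringSum (p ^ 2) 1 s =
      qProd (p ^ 2) (p ^ 2) * qProd (p ^ 4) (p ^ 4) * p ^ (s * (s - 1)) := by
  have hq0 : p ^ 2 ≠ 0 := pow_ne_zero 2 hp0
  have hq : ‖p ^ 2‖ < 1 := by rw [norm_pow]; exact pow_lt_one₀ (norm_nonneg p) hp two_ne_zero
  have hE := qProd_self_ne_zero hq
  have h1 := mul_stringSum_one hp0 hp s
  have h2 := j_self_sq hq0 hq
  rw [show (p ^ 2) ^ 2 = p ^ 4 by ring] at h2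
  have hj : j (p ^ 2) (p ^ 4) ≠ 0 := left_ne_zero_of_mul (h2 ▸ pow_ne_zero 2 hE)
  refine mul_left_cancel₀ hj ?_
  linear_combination h1 - qProd (p ^ 2) (p ^ 2) * p ^ (s * (s - 1)) * h2

lemma stringSum_zero_add_two {p : ℂ} (hp0 : p ≠ 0) (hp : ‖p‖ < 1) (N : ℤ) :
    stringSum (p ^ 2) 0 N + p * stringSum (p ^ 2) 2 (N + 1) =
      p ^ N ^ 2 * j (p ^ 2) ((p ^ 2) ^ 2) *
        (j (-(p ^ 2) ^ 3) ((p ^ 2) ^ 8) + p * j (-p ^ 2) ((p ^ 2) ^ 8)) := by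
  have hq0 : p ^ 2 ≠ 0 := pow_ne_zero 2 hp0
  have hq : ‖p ^ 2‖ < 1 := by rw [norm_pow]; exact pow_lt_one₀ (norm_nonneg p) hp two_ne_zero
  have h1 := mul_stringSum_zero_add_two hp0 hp N
  have h2 := j_self_sq hq0 hq
  have h3 := j_pow_four_mul_neg hp0 hp
  rw [← j_neg_pow_four hp0 hp]
  refine mul_left_cancel₀ (j_pow_four_ne_zero hp0 hp) ?_
  rw [show (p ^ 2) ^ 2 = p ^ 4 by ring] at h2 ⊢
  linear_combination h1 - p ^ N ^ 2 * j (p ^ 2) (p ^ 4) * h3 -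
    p ^ N ^ 2 * qProd (p ^ 2) (p ^ 2) * h2

/-- The two signs of `p` separate the sums for `ℓ = 0` and `ℓ = 2`, which depend on `p ^ 2`
only. -/
lemma stringSum_zero_sub_two {p : ℂ} (hp0 : p ≠ 0) (hp : ‖p‖ < 1) (N : ℤ) :
    stringSum (p ^ 2) 0 N - p * stringSum (p ^ 2) 2 (N + 1) =
      (-p) ^ N ^ 2 * j (p ^ 2) ((p ^ 2) ^ 2) *
        (j (-(p ^ 2) ^ 3) ((p ^ 2) ^ 8) - p * j (-p ^ 2) ((p ^ 2) ^ 8)) := by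
  have h := stringSum_zero_add_two (neg_ne_zero.mpr hp0) (by rwa [norm_neg]) N
  rw [even_two.neg_pow] at h
  linear_combination h

/-! ### Specialization to `q = exp (2 π i τ)` -/

lemma qPow_half_ne_zero (τ : UpperHalfPlane) : qPow τ (1 / 2) ≠ 0 := Complex.exp_ne_zero _

lemma norm_qPow_half_lt_one (τ : UpperHalfPlane) : ‖qPow τ (1 / 2)‖ < 1 := by
  rw [qPow, Complex.norm_exp, Real.exp_lt_one_iff]
  have h : (2 * Real.pi * Complex.I * ((1 / 2 : ℚ) : ℂ) * (τ : ℂ)).re = -(Real.pi * τ.im) := by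
    have : 2 * Real.pi * Complex.I * ((1 / 2 : ℚ) : ℂ) * (τ : ℂ) =
        (Real.pi : ℂ) * (Complex.I * τ) := by
      push_cast
      ring
    rw [this, Complex.re_ofReal_mul, Complex.I_mul_re, UpperHalfPlane.coe_im]
    ring
  rw [h]
  exact neg_lt_zero.mpr (mul_pos Real.pi_pos τ.im_pos)

/-- All powers of `q` that occur have exponents in `ℤ / 2`, so they are integral powers of
`q ^ (1 / 2)`. -/
lemma qPow_eq_zpow (τ : UpperHalfPlane) {r : ℚ} {n : ℤ} (h : r * 2 = n) :
    qPow τ r = qPow τ (1 / 2) ^ n := by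
  rw [qPow, qPow, ← Complex.exp_int_mul]
  have h' : (n : ℂ) = (r : ℂ) * 2 := by
    have := congrArg (fun x : ℚ => (x : ℂ)) h
    push_cast at this
    exact this.symm
  rw [h']
  push_cast
  ring_nf

lemma qPow_intCast (τ : UpperHalfPlane) (n : ℤ) : qPow τ n = (qPow τ (1 / 2) ^ 2) ^ n := by
  rw [sq_zpow]
  exact qPow_eq_zpow τ (by push_cast; ring)

lemma qPow_add (τ : UpperHalfPlane) (r s : ℚ) : qPow τ (r + s) = qPow τ r * qPow τ s := by
  rw [qPow, qPow, qPow, ← Complex.exp_add]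
  push_cast
  ring_nf

lemma J₂_eq (τ : UpperHalfPlane) (a m : ℤ) :
    J₂ τ a m = j ((qPow τ (1 / 2) ^ 2) ^ a) ((qPow τ (1 / 2) ^ 2) ^ m) := by
  rw [J₂, qPow_intCast, qPow_intCast]

lemma Jbar_eq (τ : UpperHalfPlane) (a m : ℤ) :
    Jbar τ a m = j (-(qPow τ (1 / 2) ^ 2) ^ a) ((qPow τ (1 / 2) ^ 2) ^ m) := by
  rw [Jbar, qPow_intCast, qPow_intCast]

lemma norm_sq_qPow_half_lt_one (τ : UpperHalfPlane) : ‖qPow τ (1 / 2) ^ 2‖ < 1 := by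
  rw [norm_pow]
  exact pow_lt_one₀ (norm_nonneg _) (norm_qPow_half_lt_one τ) two_ne_zero

lemma J₁_one (τ : UpperHalfPlane) :
    J₁ τ 1 = qProd (qPow τ (1 / 2) ^ 2) (qPow τ (1 / 2) ^ 2) := by
  rw [J₁, J₂_eq, ← j_self_cube (pow_ne_zero 2 (qPow_half_ne_zero τ)) (norm_sq_qPow_half_lt_one τ),
    zpow_one, mul_one, zpow_ofNat]

lemma J₁_two (τ : UpperHalfPlane) :
    J₁ τ 2 = qProd (qPow τ (1 / 2) ^ 4) (qPow τ (1 / 2) ^ 4) := by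
  have h : ‖qPow τ (1 / 2) ^ 4‖ < 1 := by
    rw [norm_pow]
    exact pow_lt_one₀ (norm_nonneg _) (norm_qPow_half_lt_one τ) four_ne_zero
  rw [J₁, J₂_eq, ← j_self_cube (pow_ne_zero 4 (qPow_half_ne_zero τ)) h, ← pow_mul]
  norm_cast
  rw [← pow_mul, ← pow_mul]

/-- The terms of the string function are those of two partial theta series; `s = (m + ℓ) / 2`. -/
lemma stringTerm_eq (τ : UpperHalfPlane) (ℓ s k : ℤ) (i : ℕ) :
    stringTerm τ 2 (2 * s - ℓ) ℓ k i =
      (qPow τ (1 / 2) ^ 2) ^ (4 * k ^ 2 + (ℓ + 1) * k) *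
        (thetaCoeff (qPow τ (1 / 2) ^ 2) i *
            ((qPow τ (1 / 2) ^ 2) ^ (4 * k + s + 1)) ^ i -
          thetaCoeff (qPow τ (1 / 2) ^ 2) i *
            ((qPow τ (1 / 2) ^ 2) ^ (-4 * k + (s - ℓ - 1) + 1)) ^ i) := by
  have hp0 := qPow_half_ne_zero τ
  have e1 := qPow_eq_zpow τ
    (r := 1 / 2 * (i : ℚ) * ((i : ℚ) + (2 * s - ℓ : ℤ)) +
      (k : ℚ) * ((((2 : ℤ) : ℚ) + 2) * k + ℓ + 1) +
      1 / 2 * (i : ℚ) * (2 * (((2 : ℤ) : ℚ) + 2) * k + ℓ + 1))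
    (n := 2 * (4 * k ^ 2 + (ℓ + 1) * k) + (i * (i - 1) + 2 * (4 * k + s + 1) * i))
    (by push_cast; ring)
  have e2 := qPow_eq_zpow τ
    (r := 1 / 2 * (i : ℚ) * ((i : ℚ) + (2 * s - ℓ : ℤ)) +
      (k : ℚ) * ((((2 : ℤ) : ℚ) + 2) * k + ℓ + 1) +
      -(1 / 2 * (i : ℚ) * (2 * (((2 : ℤ) : ℚ) + 2) * k + ℓ + 1)))
    (n := 2 * (4 * k ^ 2 + (ℓ + 1) * k) + (i * (i - 1) + 2 * (-4 * k + (s - ℓ - 1) + 1) * i))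
    (by push_cast; ring)
  rw [qPow_add, zpow_add₀ hp0, zpow_add₀ hp0] at e1 e2
  rw [stringTerm, mul_assoc, mul_sub, e1, e2, thetaCoeff_sq, sq_zpow, sq_zpow, sq_zpow,
    ← zpow_natCast (_ ^ _) i, ← zpow_natCast (_ ^ _) i, ← zpow_mul, ← zpow_mul, zpow_natCast]
  ring

lemma hasSum_stringTerm (τ : UpperHalfPlane) (ℓ s k : ℤ) :
    HasSum (stringTerm τ 2 (2 * s - ℓ) ℓ k)
      ((qPow τ (1 / 2) ^ 2) ^ (4 * k ^ 2 + (ℓ + 1) * k) *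
        (recipCoeff (qPow τ (1 / 2) ^ 2) (4 * k + s) -
          recipCoeff (qPow τ (1 / 2) ^ 2) (-4 * k + (s - ℓ - 1)))) := by
  have hq0 := pow_ne_zero 2 (qPow_half_ne_zero τ)
  have hq := norm_sq_qPow_half_lt_one τ
  rw [funext (stringTerm_eq τ ℓ s k)]
  exact ((summable_partialTheta hq0 hq (zpow_ne_zero _ hq0)).hasSum.sub
    (summable_partialTheta hq0 hq (zpow_ne_zero _ hq0)).hasSum).mul_left _

lemma J₁_one_ne_zero (τ : UpperHalfPlane) : J₁ τ 1 ≠ 0 := by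
  rw [J₁_one]
  exact qProd_self_ne_zero (norm_sq_qPow_half_lt_one τ)

lemma J₁_cube_mul_stringC (τ : UpperHalfPlane) (ℓ s : ℤ) :
    J₁ τ 1 ^ 3 * stringC τ 2 (2 * s - ℓ) ℓ = stringSum (qPow τ (1 / 2) ^ 2) ℓ s := by
  rw [stringC, ← mul_assoc, mul_one_div_cancel (pow_ne_zero 3 (J₁_one_ne_zero τ)), one_mul,
    stringSum]
  exact tsum_congr fun k => (hasSum_stringTerm τ ℓ s k).tsum_eq

end StringFunction

open StringFunction
theorem theorem2p5 (τ : UpperHalfPlane) (m ℓ : ℤ) (hℓ : ℓ ∈ ({0, 1, 2} : Set ℤ))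
    (hm0 : 0 ≤ m) (hm4 : m < 4) (hmod : m ≡ ℓ [ZMOD 2]) :
    -- the expression defining `𝒞^2_{m,ℓ}(q)` is meaningful
    J₁ τ 1 ≠ 0 ∧
    (∀ k : ℤ, Summable fun i : ℕ => stringTerm τ 2 m ℓ k i) ∧
    (Summable fun k : ℤ => ∑' i : ℕ, stringTerm τ 2 m ℓ k i) ∧
    -- and it has the following values
    (ℓ = 0 → m = 0 →
      qPow τ (-(1 / 8 * ((m : ℚ) ^ 2 - (ℓ : ℚ) ^ 2))) * J₁ τ 1 ^ 3 * stringC τ 2 m ℓ =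
        J₂ τ 1 2 * Jbar τ 3 8) ∧
    (ℓ = 0 → m = 2 →
      qPow τ (-(1 / 8 * ((m : ℚ) ^ 2 - (ℓ : ℚ) ^ 2))) * J₁ τ 1 ^ 3 * stringC τ 2 m ℓ =
        qPow τ (1 / 2) * J₂ τ 1 2 * Jbar τ 1 8) ∧
    (ℓ = 1 → m = 1 ∨ m = 3 →
      qPow τ (-(1 / 8 * ((m : ℚ) ^ 2 - (ℓ : ℚ) ^ 2))) * J₁ τ 1 ^ 3 * stringC τ 2 m ℓ =
        J₁ τ 1 * J₁ τ 2) ∧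
    (ℓ = 2 → m = 0 →
      qPow τ (-(1 / 8 * ((m : ℚ) ^ 2 - (ℓ : ℚ) ^ 2))) * J₁ τ 1 ^ 3 * stringC τ 2 m ℓ =
        qPow τ (1 / 2) * J₂ τ 1 2 * Jbar τ 1 8) ∧
    (ℓ = 2 → m = 2 →
      qPow τ (-(1 / 8 * ((m : ℚ) ^ 2 - (ℓ : ℚ) ^ 2))) * J₁ τ 1 ^ 3 * stringC τ 2 m ℓ =
        J₂ τ 1 2 * Jbar τ 3 8) := by
  obtain ⟨s, rfl⟩ : ∃ s, m = 2 * s - ℓ := by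
    obtain ⟨c, hc⟩ := (Int.modEq_iff_dvd.mp hmod)
    exact ⟨ℓ - c, by linarith⟩
  have hp0 := qPow_half_ne_zero τ
  have hp := norm_qPow_half_lt_one τ
  have hq0 := pow_ne_zero 2 hp0
  have hq := norm_sq_qPow_half_lt_one τ
  have hJ : J₂ τ 1 2 = j (qPow τ (1 / 2) ^ 2) ((qPow τ (1 / 2) ^ 2) ^ 2) := by
    rw [J₂_eq, zpow_one, zpow_ofNat]
  have hA : Jbar τ 3 8 = j (-(qPow τ (1 / 2) ^ 2) ^ 3) ((qPow τ (1 / 2) ^ 2) ^ 8) := by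
    rw [Jbar_eq, zpow_ofNat, zpow_ofNat]
  have hB : Jbar τ 1 8 = j (-qPow τ (1 / 2) ^ 2) ((qPow τ (1 / 2) ^ 2) ^ 8) := by
    rw [Jbar_eq, zpow_one, zpow_ofNat]
  have hadd := stringSum_zero_add_two hp0 hp
  have hsub := stringSum_zero_sub_two hp0 hp
  rw [← hJ, ← hA, ← hB] at hadd hsub
  have hadd0 := hadd 0
  have hsub0 := hsub 0
  have hadd1 := hadd 1
  have hsub1 := hsub 1
  norm_num at hadd0 hsub0 hadd1 hsub1
  have hpre (n : ℤ) (h : -(1 / 8 * (((2 * s - ℓ : ℤ) : ℚ) ^ 2 - (ℓ : ℚ) ^ 2)) * 2 = n) :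
      qPow τ (-(1 / 8 * (((2 * s - ℓ : ℤ) : ℚ) ^ 2 - (ℓ : ℚ) ^ 2))) * J₁ τ 1 ^ 3 *
        stringC τ 2 (2 * s - ℓ) ℓ =
      qPow τ (1 / 2) ^ n * stringSum (qPow τ (1 / 2) ^ 2) ℓ s := by
    rw [mul_assoc, J₁_cube_mul_stringC, qPow_eq_zpow τ h]
  refine ⟨J₁_one_ne_zero τ, fun k => (hasSum_stringTerm τ ℓ s k).summable, ?_, ?_, ?_, ?_, ?_, ?_⟩
  · exact (summable_stringSum hq0 hq ℓ s).congr fun k => (hasSum_stringTerm τ ℓ s k).tsum_eq.symm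
  · rintro rfl hm
    obtain rfl : s = 0 := by lia
    rw [hpre 0 (by norm_num), zpow_zero, one_mul]
    linear_combination (hadd0 + hsub0) / 2
  · rintro rfl hm
    obtain rfl : s = 1 := by lia
    rw [hpre (-1) (by norm_num), zpow_neg_one, inv_mul_eq_iff_eq_mul₀ hp0]
    linear_combination (hadd1 + hsub1) / 2
  · rintro rfl hm
    rcases hm with hm | hm
    · obtain rfl : s = 1 := by lia
      rw [hpre 0 (by norm_num), stringSum_one hp0 hp, J₁_one, J₁_two]
      norm_num
    · obtain rfl : s = 2 := by lia
      rw [hpre (-2) (by norm_num), stringSum_one hp0 hp, J₁_one, J₁_two, mul_left_comm,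
        ← zpow_add₀ hp0]
      norm_num
  · rintro rfl hm
    obtain rfl : s = 1 := by lia
    rw [hpre 1 (by norm_num), zpow_one]
    linear_combination (hadd0 - hsub0) / 2
  · rintro rfl hm
    obtain rfl : s = 2 := by lia
    rw [hpre 0 (by norm_num), zpow_zero, one_mul]
    refine mul_left_cancel₀ hp0 ?_
    linear_combination (hadd1 - hsub1) / 2
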